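/- Let $G$ be a finite undirected graph, possibly with loops, multiple edges and several components, with vertex set $V(G)$ and edge set $E(G)$. Fix a reference orientation (a positive direction $e^+$, hence also a negative direction $e^-$, of each edge $e$; for a loop, $e^+$ and $e^-$ are two distinct formal symbols), a total order $<$ on $E(G)$, and arbitrary sign labels $\sigma_u,\sigma_b\colon E(G)\to\{+,-\}$. Let $\mathcal S(G)=2^{E(G)}$ be the set of spanning subgraphs, identified with their edge sets, and let $\kappa(S)$ be the number of connected components of $(V(G),S)$. A *cut* is a minimal nonempty $C\subseteq E(G)$ with $\kappa(E(G)\setminus C)>\kappa(E(G))$; a *cycle* is a minimal nonempty $C\subseteq E(G)$ such that no cut contains precisely one element of $C$. For $S\in\mathcal S(G)$ let $\hat I(S)$ be the set of edges $e$ that are the $<$-minimum of some cut $C$ with $C\cap(S\setminus\{e\})=\varnothing$, and $\hat L(S)$ the set of edges $e$ that are the $<$-minimum of some cycle $C\subseteq S\cup\{e\}$. A *directed cut* is a cut, consisting of the edges between some $X\subseteq V(G)$ and its complement, with all its edges directed out of $X$ or all directed into $X$; a *directed cycle* is a cycle with one of its two consistent orientations. A *fourientation* is an arbitrary subset $O$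 of $\{e^+,e^-: e\in E(G)\}$; $\mathcal O^4(G)$ is the set of fourientations. Let $O^u$, $O^b$ and $O^o$ be the sets of edges having respectively none, both and exactly one of their two directions in $O$, and let $O^{+}$ (resp. $O^{-}$) be the set of $e\in O^o$ with $e^+\in O$ (resp. $e^-\in O$). A *potential cut* of $O$ is a directed cut such that $e^{-\delta}\notin O$ for each of its directed edges $e^\delta$; a *potential cycle* of $O$ is a directed cycle all of whose directed edges lie in $O$. Put - $I^o(O)=\{e\in O^o: e$ is the minimum edge of some potential cut of $O\}$, - $L^o(O)=\{e\in O^o: e$ is the minimum edge of some potential cycle of $O\}$, - $I^u(O)=\{e\in O^u: e$ is the minimum edge of some potential cut of $O\cup\{e^{\sigma_u(e)}\}\}$, - $L^b(O)=\{e\in O^b: e$ is the minimum edge of some potential cycle of $O\setminus\{e^{\sigma_b(e)}\}\}$. **Theorem.** There exists a surjection $\varphi\colon\mathcal O^4(G)\to\mathcal S(G)$, each of whose fibres has exactly $2^{|E(G)|}$ elements, such that 1. $O\mapsto(\varphi(O),O^o)$ is a bijection from $\mathcal O^4(G)$ onto $\mathcal S(G)\times\mathcal S(G)$; 2. $O^u\cap\varphi(O)=\varnothing$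 and $O^b\subseteq\varphi(O)$ for all $O$; 3. with $I(O):=\hat I(\varphi(O))$ and $L(O):=\hat L(\varphi(O))$, for all $O$: $I(O)\cap O^o=I^o(O)$, $I(O)\cap O^u=I^u(O)$, $L(O)\cap O^o=L^o(O)$, $L(O)\cap O^b=L^b(O)$; 4. for all $O$: $I(O)\cap O^+\subseteq\varphi(O)$, $(I(O)\cap O^-)\cap\varphi(O)=\varnothing$, $L(O)\cap O^-\subseteq\varphi(O)$, $(L(O)\cap O^+)\cap\varphi(O)=\varnothing$; 5. if $O^o=\varnothing$ then $I(O)=\hat I(O^b)$ and $L(O)=\hat L(O^b)$. -/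

import Mathlib

open scoped Graph

namespace Graph

variable {α β : Type*}

/-- Spanning subgraphs of `G`, identified with their edge sets. -/
abbrev SpanningSubgraph (G : Graph α β) : Type _ := Set E(G)

/-- The set of formal symbols `e⁺`, `e⁻`, one pair for each edge `e`:
`(e, true)` is `e⁺` and `(e, false)` is `e⁻`. -/
abbrev Dart (G : Graph α β) : Type _ := E(G) × Bool

/-- A fourientation of `G` is an arbitrary set of directions of edges. -/
abbrev Fourientation (G : Graph α β) : Type _ := Set G.Dart

/-- The number of connected components of the spanning subgraph `(V(G), S)`. -/
noncomputable def numComponents (G : Graph α β) (S : G.SpanningSubgraph) : ℕ :=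
  Nat.card (Quot fun x y : V(G) => ∃ e ∈ S, G.IsLink e x y)

/-- A cut is a minimal nonempty set of edges whose removal increases the number of connected
components. -/
def IsCut (G : Graph α β) (C : Set E(G)) : Prop :=
  Minimal (fun S : Set E(G) => S.Nonempty ∧ G.numComponents Set.univ < G.numComponents Sᶜ) C

/-- A cycle is a minimal nonempty set of edges that no cut meets in precisely one element. -/
def IsCycle (G : Graph α β) (C : Set E(G)) : Prop :=
  Minimal (fun S : Set E(G) => S.Nonempty ∧ ∀ K, G.IsCut K → ¬ ∃ e, K ∩ S = {e}) C

section GeneralizedActivities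

variable (G : Graph α β) [LinearOrder E(G)]

/-- The edges that are cut active with respect to a spanning subgraph `S`. -/
def genCutActive (S : G.SpanningSubgraph) : Set E(G) :=
  {e | ∃ C, G.IsCut C ∧ C ∩ (S \ {e}) = ∅ ∧ IsLeast C e}

/-- The edges that are cycle active with respect to a spanning subgraph `S`. -/
def genCycleActive (S : G.SpanningSubgraph) : Set E(G) :=
  {e | ∃ C, G.IsCycle C ∧ C ⊆ S ∪ {e} ∧ IsLeast C e}

end GeneralizedActivities

/-- A reference orientation: the positive direction of the edge `e` goes from `tail e` to
`head e`. -/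
structure RefOrientation (G : Graph α β) where
  tail : E(G) → V(G)
  head : E(G) → V(G)
  isLink : ∀ e : E(G), G.IsLink e (tail e) (head e)

namespace Fourientation

variable {G : Graph α β}

/-- The set of unoriented edges. -/
def unoriented (O : G.Fourientation) : Set E(G) := {e | (e, true) ∉ O ∧ (e, false) ∉ O}

/-- The set of bioriented edges. -/
def bioriented (O : G.Fourientation) : Set E(G) := {e | (e, true) ∈ O ∧ (e, false) ∈ O}

/-- The set of (simply) oriented edges that agree with the reference orientation. -/
def positive (O : G.Fourientation) : Set E(G) := {e | (e, true) ∈ O ∧ (e, false) ∉ O}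

/-- The set of (simply) oriented edges that disagree with the reference orientation. -/
def negative (O : G.Fourientation) : Set E(G) := {e | (e, true) ∉ O ∧ (e, false) ∈ O}

/-- The set of (simply) oriented edges: those neither unoriented nor bioriented. -/
def oriented (O : G.Fourientation) : Set E(G) := {e | e ∉ O.unoriented ∧ e ∉ O.bioriented}

end Fourientation

namespace RefOrientation

variable {G : Graph α β} (R : G.RefOrientation)

/-- The vertex from which the directed edge `e^δ` starts. -/
def source (d : G.Dart) : V(G) := if d.2 then R.tail d.1 else R.head d.1

/-- The vertex at which the directed edge `e^δ` ends. -/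
def target (d : G.Dart) : V(G) := if d.2 then R.head d.1 else R.tail d.1

/-- `D` is the set of directed edges of a directed cut: a cut all of whose edges are directed
out of some vertex set `X`. (Orienting it into `X` is orienting it out of the complement.) -/
def IsDirectedCut (D : Set G.Dart) : Prop :=
  G.IsCut (Prod.fst '' D) ∧
    ∃ X : Set V(G), D = {d | R.source d ∈ X ∧ R.target d ∉ X}

/-- `D` is the set of directed edges of a directed cycle: a cycle each of whose edges carries
exactly one direction, consistently: every vertex is entered as often as it is left. -/
def IsDirectedCycle (D : Set G.Dart) : Prop :=
  G.IsCycle (Prod.fst '' D) ∧ (∀ e, ¬ ((e, true) ∈ D ∧ (e, false) ∈ D)) ∧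
    ∀ v : V(G), {d | d ∈ D ∧ R.target d = v}.ncard = {d | d ∈ D ∧ R.source d = v}.ncard

/-- `D` is a potential cut of the fourientation `O`. -/
def IsPotentialCut (O : G.Fourientation) (D : Set G.Dart) : Prop :=
  R.IsDirectedCut D ∧ ∀ e δ, (e, δ) ∈ D → (e, !δ) ∉ O

/-- `D` is a potential cycle of the fourientation `O`. -/
def IsPotentialCycle (O : G.Fourientation) (D : Set G.Dart) : Prop :=
  R.IsDirectedCycle D ∧ ∀ e δ, (e, δ) ∈ D → (e, δ) ∈ O

variable [LinearOrder E(G)]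

/-- `e` is the minimum edge in some potential cut of `O`. -/
def IsMinOfPotentialCut (O : G.Fourientation) (e : E(G)) : Prop :=
  ∃ D, R.IsPotentialCut O D ∧ IsLeast (Prod.fst '' D) e

/-- `e` is the minimum edge in some potential cycle of `O`. -/
def IsMinOfPotentialCycle (O : G.Fourientation) (e : E(G)) : Prop :=
  ∃ D, R.IsPotentialCycle O D ∧ IsLeast (Prod.fst '' D) e

/-- The set `I^o(O)`. -/
def cutActiveOriented (O : G.Fourientation) : Set E(G) :=
  {e | e ∈ O.oriented ∧ R.IsMinOfPotentialCut O e}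

/-- The set `L^o(O)`. -/
def cycleActiveOriented (O : G.Fourientation) : Set E(G) :=
  {e | e ∈ O.oriented ∧ R.IsMinOfPotentialCycle O e}

/-- The set `I^u(O)`, for the sign labels `σu`. -/
def cutActiveUnoriented (σu : E(G) → Bool) (O : G.Fourientation) : Set E(G) :=
  {e | e ∈ O.unoriented ∧ R.IsMinOfPotentialCut (O ∪ {(e, σu e)}) e}

/-- The set `L^b(O)`, for the sign labels `σb`. -/
def cycleActiveBioriented (σb : E(G) → Bool) (O : G.Fourientation) : Set E(G) :=
  {e | e ∈ O.bioriented ∧ R.IsMinOfPotentialCycle (O \ {(e, σb e)}) e}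

end RefOrientation

end Graph

/-! Both kinds of activity are questions of reachability. Direct `e` by a test direction: its own if
it is simply oriented, `σu e` if it is unoriented, the opposite of `σb e` if it is bioriented. Then
`e` is cycle active when its end leads back to its start along the larger directed edges of `O`, and
cut active when its end does not lead back even if all smaller edges may be used both ways
(`cycleActiveOriented_iff`, `cutActiveOriented_iff` and their companions). A spanning subgraph
behaves as the fourientation that biorients its edges and leaves the others unoriented.

The map `φ` makes each oriented edge bioriented (kept) or unoriented (dropped), from the largest
edge down, without altering the activity of any smaller edge. When `m` is treated, let `N` be the
current fourientation without `m`. A direction of `m` gains if adding it to `N` makes some smaller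
tested edge return. The heart of the proof is `not_gains_not`: the two directions of `m` cannot both
gain. So a gaining direction may be completed to a bioriented edge, and a direction that does not
gain may be dropped (`returns_insert_insert_of_not_gains`, `returns_insert_of_not_gains`).

If neither direction gains, both choices are harmless, and the rule is fixed so that the signs come
out right. Active edges never gain (`not_gains_of_not_reach`, `not_gains_of_reach`), so only this
tie-break concerns them. In every case exactly one of the two directions of `m` is kept, and the
rule depends only on the result above `m` and on `O` below `m`. Hence `O` can be recovered from `φ
O` and the set of oriented edges, from the smallest edge up; counting then gives the bijection. -/

namespace Graph

variable {α β : Type*}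

namespace RefOrientation

/-! ### Directed reachability. -/

variable {G : Graph α β} (R : G.RefOrientation)

/-- `y` can be reached from `x` along directed edges in `D`. -/
def Reach (D : Set G.Dart) : V(G) → V(G) → Prop :=
  Relation.ReflTransGen fun x y => ∃ d ∈ D, R.source d = x ∧ R.target d = y

/-- The set of all directions of the edges in `S`. -/
def darts (S : Set E(G)) : Set G.Dart := {d | d.1 ∈ S}

@[simp] lemma mem_darts {S : Set E(G)} {d : G.Dart} : d ∈ darts S ↔ d.1 ∈ S := Iff.rfl

@[simp] lemma source_not (e : E(G)) (δ : Bool) : R.source (e, !δ) = R.target (e, δ) := by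
  cases δ <;> rfl

@[simp] lemma target_not (e : E(G)) (δ : Bool) : R.target (e, !δ) = R.source (e, δ) := by
  cases δ <;> rfl

variable {R}

lemma Reach.refl {D : Set G.Dart} (x : V(G)) : R.Reach D x x := Relation.ReflTransGen.refl

lemma Reach.trans {D : Set G.Dart} {x y z : V(G)} (h : R.Reach D x y) (h' : R.Reach D y z) :
    R.Reach D x z := Relation.ReflTransGen.trans h h'

lemma reach_of_mem {D : Set G.Dart} {d : G.Dart} (h : d ∈ D) :
    R.Reach D (R.source d) (R.target d) := Relation.ReflTransGen.single ⟨d, h, rfl, rfl⟩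

lemma Reach.mono {D D' : Set G.Dart} (hD : D ⊆ D') {x y : V(G)} (h : R.Reach D x y) :
    R.Reach D' x y :=
  Relation.ReflTransGen.mono (fun _ _ ⟨d, hd, h⟩ => ⟨d, hD hd, h⟩) x y h

/-- A set of vertices that no directed edge of `D` leaves contains what it reaches. -/
lemma Reach.mem_of_closed {D : Set G.Dart} {x y : V(G)} (h : R.Reach D x y) (Y : Set V(G))
    (hx : x ∈ Y) (hY : ∀ d ∈ D, R.source d ∈ Y → R.target d ∈ Y) : y ∈ Y := by
  induction h with
  | refl => exact hx
  | tail _ h ih =>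
    obtain ⟨d, hd, rfl, rfl⟩ := h
    exact hY d hd ih

lemma Reach.symm_of_symmetric {D : Set G.Dart} (hD : ∀ e δ, (e, δ) ∈ D → (e, !δ) ∈ D)
    {x y : V(G)} (h : R.Reach D x y) : R.Reach D y x := by
  refine h.mem_of_closed {z | R.Reach D z x} (.refl x) fun d hd hs => ?_
  have := reach_of_mem (R := R) (hD d.1 d.2 hd)
  rw [source_not, target_not] at this
  exact this.trans hs

lemma Reach.symm_darts {S : Set E(G)} {x y : V(G)} (h : R.Reach (darts S) x y) :
    R.Reach (darts S) y x := h.symm_of_symmetric fun _ _ h => h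

/-- A walk needs `m` at most once: everything between its first and its last use of `m` can be cut
out. -/
lemma reach_insert {D : Set G.Dart} {m : G.Dart} {x y : V(G)} :
    R.Reach (insert m D) x y ↔
      R.Reach D x y ∨ (R.Reach D x (R.source m) ∧ R.Reach D (R.target m) y) := by
  constructor
  · intro h
    refine h.mem_of_closed
      {z | R.Reach D x z ∨ (R.Reach D x (R.source m) ∧ R.Reach D (R.target m) z)}
      (.inl (.refl x)) fun d hd hs => ?_
    rcases hd with rfl | hd
    · rcases hs with hs | hs
      · exact .inr ⟨hs, .refl _⟩
      · exact .inr ⟨hs.1, .refl _⟩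
    · rcases hs with hs | hs
      · exact .inl (hs.trans (reach_of_mem hd))
      · exact .inr ⟨hs.1, hs.2.trans (reach_of_mem hd)⟩
  · have hsub := Set.subset_insert m D
    rintro (h | ⟨h, h'⟩)
    · exact h.mono hsub
    · exact ((h.mono hsub).trans (reach_of_mem (Set.mem_insert m D))).trans (h'.mono hsub)

/-! ### Cuts and connectivity -/

lemma isLink_iff_exists_dart {e : E(G)} {x y : V(G)} :
    G.IsLink e x y ↔ ∃ δ, R.source (e, δ) = x ∧ R.target (e, δ) = y := by
  constructor
  · intro h
    rcases (R.isLink e).eq_and_eq_or_eq_and_eq h with ⟨h1, h2⟩ | ⟨h1, h2⟩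
    · exact ⟨true, Subtype.ext h1, Subtype.ext h2⟩
    · exact ⟨false, Subtype.ext h2, Subtype.ext h1⟩
  · rintro ⟨δ, rfl, rfl⟩
    cases δ
    · exact (R.isLink e).symm
    · exact R.isLink e

lemma reach_darts_iff {S : Set E(G)} {x y : V(G)} :
    R.Reach (darts S) x y ↔ Quot.mk (fun x y : V(G) => ∃ e ∈ S, G.IsLink e x y) x =
      Quot.mk (fun x y : V(G) => ∃ e ∈ S, G.IsLink e x y) y := by
  constructor
  · intro h
    refine h.mem_of_closed {z | Quot.mk _ x = Quot.mk _ z} rfl fun d hd hs => ?_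
    exact hs.trans (Quot.sound ⟨d.1, hd, isLink_iff_exists_dart.2 ⟨d.2, rfl, rfl⟩⟩)
  · intro h
    have h' := Quot.eqvGen_exact h
    clear h
    induction h' with
    | rel x y h =>
      obtain ⟨e, he, h⟩ := h
      obtain ⟨δ, rfl, rfl⟩ := (isLink_iff_exists_dart (R := R)).1 h
      exact reach_of_mem (D := darts S) (d := (e, δ)) he
    | refl x => exact .refl x
    | symm x y h ih => exact ih.symm_darts
    | trans x y z h h' ih ih' =>
      exact ih.trans ih'

lemma numComponents_lt_iff [Finite V(G)] {S : Set E(G)} :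
    G.numComponents Set.univ < G.numComponents Sᶜ ↔
      ∃ f, ¬ R.Reach (darts Sᶜ) (R.tail f) (R.head f) := by
  constructor
  · intro h
    by_contra! hc
    refine h.not_ge ?_
    let g : Quot (fun x y : V(G) => ∃ e ∈ (Set.univ : Set E(G)), G.IsLink e x y) →
        Quot (fun x y : V(G) => ∃ e ∈ Sᶜ, G.IsLink e x y) :=
      Quot.lift (Quot.mk _) (by
        rintro x y ⟨e, -, h⟩
        rw [← reach_darts_iff (R := R)]
        obtain ⟨δ, rfl, rfl⟩ := (isLink_iff_exists_dart (R := R)).1 h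
        cases δ
        · exact (hc e).symm_darts
        · exact hc e)
    exact Nat.card_le_card_of_surjective g (Quot.ind fun x => ⟨Quot.mk _ x, rfl⟩)
  · rintro ⟨f, hf⟩
    let g : Quot (fun x y : V(G) => ∃ e ∈ Sᶜ, G.IsLink e x y) →
        Quot (fun x y : V(G) => ∃ e ∈ (Set.univ : Set E(G)), G.IsLink e x y) :=
      Quot.map id (by rintro x y ⟨e, -, h⟩; exact ⟨e, trivial, h⟩)
    have hg : Function.Surjective g := Quot.ind fun x => ⟨Quot.mk _ x, rfl⟩
    refine lt_of_le_of_ne (Nat.card_le_card_of_surjective g hg) fun heq => hf ?_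
    have hb := (Nat.bijective_iff_surjective_and_card g).2 ⟨hg, heq.symm⟩
    rw [reach_darts_iff]
    exact hb.1 (Quot.sound ⟨f, trivial, R.isLink f⟩)

lemma isCut_iff [Finite V(G)] {C : Set E(G)} :
    G.IsCut C ↔
      Minimal (fun S : Set E(G) => ∃ f, ¬ R.Reach (darts Sᶜ) (R.tail f) (R.head f)) C := by
  have : (fun S : Set E(G) => S.Nonempty ∧ G.numComponents Set.univ < G.numComponents Sᶜ) =
      fun S : Set E(G) => ∃ f, ¬ R.Reach (darts Sᶜ) (R.tail f) (R.head f) := by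
    funext S
    rw [numComponents_lt_iff (R := R)]
    refine propext ⟨fun h => h.2, fun ⟨f, hf⟩ => ⟨?_, f, hf⟩⟩
    by_contra hS
    rw [Set.not_nonempty_iff_eq_empty] at hS
    subst hS
    exact hf (reach_of_mem (d := (f, true)) (by simp))
  rw [IsCut, this]

/-- Directed edges whose reachability relation is closed under adding them are redundant. -/
lemma Reach.of_forall_mem {D D' : Set G.Dart} {x y : V(G)} (h : R.Reach D' x y)
    (hD : ∀ d ∈ D', R.Reach D (R.source d) (R.target d)) : R.Reach D x y :=
  h.mem_of_closed {z | R.Reach D x z} (.refl x) fun d hd hs => Reach.trans hs (hD d hd)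

lemma reach_dart_of_reach {S : Set E(G)} {e : E(G)} (δ : Bool)
    (h : R.Reach (darts S) (R.tail e) (R.head e)) :
    R.Reach (darts S) (R.source (e, δ)) (R.target (e, δ)) := by
  cases δ
  · exact h.symm_darts
  · exact h

/-- Otherwise `e` could be restored without reconnecting anything, so `C \ {e}` would still
disconnect, against minimality. -/
lemma not_reach_compl_of_mem_cut [Finite V(G)] {C : Set E(G)} (hC : G.IsCut C) {e : E(G)}
    (he : e ∈ C) : ¬ R.Reach (darts Cᶜ) (R.tail e) (R.head e) := by
  intro h
  rw [isCut_iff (R := R)] at hC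
  obtain ⟨f, hf⟩ := hC.prop
  have hlt : C \ {e} ⊂ C := Set.sdiff_singleton_ssubset.2 he
  refine hC.not_prop_of_ssubset hlt ⟨f, fun hr => hf (hr.of_forall_mem ?_)⟩
  rintro ⟨g, δ⟩ hg
  by_cases hge : g = e
  · subst hge
    exact reach_dart_of_reach δ h
  · refine reach_of_mem ?_
    simp only [mem_darts, Set.mem_compl_iff, Set.mem_sdiff, Set.mem_singleton_iff] at hg ⊢
    tauto

/-- The directed edges from `X` to its complement. -/
def outDarts (R : G.RefOrientation) (X : Set V(G)) : Set G.Dart :=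
  {d | R.source d ∈ X ∧ R.target d ∉ X}

@[simp] lemma mem_outDarts {X : Set V(G)} {d : G.Dart} :
    d ∈ R.outDarts X ↔ R.source d ∈ X ∧ R.target d ∉ X := Iff.rfl

lemma notMem_image_outDarts {X : Set V(G)} {d : G.Dart} (hd : d.1 ∉ Prod.fst '' R.outDarts X) :
    R.source d ∈ X ↔ R.target d ∈ X := by
  constructor
  · intro h
    by_contra h'
    exact hd ⟨d, ⟨h, h'⟩, rfl⟩
  · intro h
    by_contra h'
    refine hd ⟨(d.1, !d.2), ⟨?_, ?_⟩, rfl⟩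
    · rwa [source_not]
    · rwa [target_not]

/-- Every directed edge from `X` to its complement lies in a directed cut contained in the set of
all these directed edges. -/
lemma exists_isCut_outDarts_subset [Finite V(G)] {X₀ : Set V(G)} {d : G.Dart}
    (hd : d ∈ R.outDarts X₀) :
    ∃ X, d ∈ R.outDarts X ∧ R.outDarts X ⊆ R.outDarts X₀ ∧
      G.IsCut (Prod.fst '' R.outDarts X) := by
  classical
  -- Take `X` with as few leaving darts as possible, `d` among them. If some start of a leaving dart
  -- were not joined to the start of `d` off the cut, shrinking `X` to the component of that start
  -- would lose a dart; dually, `X` is enlarged for the ends.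
  obtain ⟨X, hX, hmin⟩ := Set.Finite.exists_minimalFor R.outDarts
    {X | d ∈ R.outDarts X ∧ R.outDarts X ⊆ R.outDarts X₀} (Set.toFinite _) ⟨X₀, hd, subset_rfl⟩
  refine ⟨X, hX.1, hX.2, ?_⟩
  set C := Prod.fst '' R.outDarts X with hC
  have hK : ∀ f ∈ darts Cᶜ, R.source f ∈ X ↔ R.target f ∈ X :=
    fun f hf => notMem_image_outDarts hf
  have hsrc : ∀ f ∈ R.outDarts X, R.Reach (darts Cᶜ) (R.source d) (R.source f) := by
    intro f hf
    by_contra hr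
    set Y := {v | v ∈ X ∧ R.Reach (darts Cᶜ) (R.source d) v} with hY
    have hsub : R.outDarts Y ⊆ R.outDarts X := by
      rintro g ⟨⟨h1, h2⟩, h3⟩
      refine ⟨h1, fun h4 => ?_⟩
      by_cases hg : g ∈ darts Cᶜ
      · exact h3 ⟨h4, h2.trans (reach_of_mem hg)⟩
      · simp only [mem_darts, Set.mem_compl_iff, not_not] at hg
        obtain ⟨g', hg', h5⟩ := hg
        have : g' = g ∨ g' = (g.1, !g.2) := by
          rcases g with ⟨g, _ | _⟩ <;> rcases g' with ⟨g', _ | _⟩ <;> simp_all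
        rcases this with rfl | rfl
        · exact hg'.2 h4
        · simp at hg'
          exact hg'.2 h1
    have hdY : d ∈ R.outDarts Y := ⟨⟨hX.1.1, .refl _⟩, fun h => hX.1.2 h.1⟩
    exact hr (hmin ⟨hdY, hsub.trans hX.2⟩ hsub hf).1.2
  have htgt : ∀ f ∈ R.outDarts X, R.Reach (darts Cᶜ) (R.target d) (R.target f) := by
    intro f hf
    by_contra hr
    set Y := {v | v ∈ X ∨ ¬ R.Reach (darts Cᶜ) (R.target d) v} with hY
    have hsub : R.outDarts Y ⊆ R.outDarts X := by
      rintro g ⟨h1, h2⟩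
      have h2X : R.target g ∉ X := fun h => h2 (.inl h)
      have h2r : R.Reach (darts Cᶜ) (R.target d) (R.target g) := by
        by_contra h
        exact h2 (.inr h)
      refine ⟨?_, h2X⟩
      by_contra h1X
      rcases h1 with h1 | h1
      · exact h1X h1
      by_cases hg : g ∈ darts Cᶜ
      · exact h1 (h2r.trans (reach_of_mem hg).symm_darts)
      · simp only [mem_darts, Set.mem_compl_iff, not_not] at hg
        obtain ⟨g', hg', h5⟩ := hg
        have : g' = g ∨ g' = (g.1, !g.2) := by
          rcases g with ⟨g, _ | _⟩ <;> rcases g' with ⟨g', _ | _⟩ <;> simp_all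
        rcases this with rfl | rfl
        · exact h1X hg'.1
        · simp at hg'
          exact h2X hg'.1
    have hdY : d ∈ R.outDarts Y :=
      ⟨.inl hX.1.1, fun h => h.elim hX.1.2 fun h => h (.refl _)⟩
    exact (hmin ⟨hdY, hsub.trans hX.2⟩ hsub hf).2 (.inr hr)
  have hsep : ¬ R.Reach (darts Cᶜ) (R.source d) (R.target d) := fun h =>
    hX.1.2 (h.mem_of_closed X hX.1.1 fun f hf hs => (hK f hf).1 hs)
  rw [isCut_iff (R := R), Set.minimal_iff_forall_ssubset]
  refine ⟨⟨d.1, fun h => hsep (reach_dart_of_reach d.2 h)⟩, ?_⟩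
  rintro T hT ⟨g, hg⟩
  obtain ⟨f, ⟨f, hf, rfl⟩, hfT⟩ := Set.exists_of_ssubset hT
  have hmono : darts Cᶜ ⊆ darts (G := G) Tᶜ := fun a ha hb => ha (hT.1 hb)
  -- One restored edge `f` bridges the two sides, which joins the ends of every edge of the cut.
  have hbridge : R.Reach (darts Tᶜ) (R.source d) (R.target d) :=
    (((hsrc f hf).mono hmono).trans (reach_of_mem (D := darts Tᶜ) (d := f) hfT)).trans
      ((htgt f hf).mono hmono).symm_darts
  have hout : ∀ a ∈ R.outDarts X, R.Reach (darts Tᶜ) (R.source a) (R.target a) := fun a ha =>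
    (((hsrc a ha).mono hmono).symm_darts.trans hbridge).trans ((htgt a ha).mono hmono)
  refine hg ?_
  by_cases hgC : g ∈ C
  · obtain ⟨⟨a, δ⟩, ha, rfl⟩ := hgC
    have := hout _ ha
    cases δ
    · exact this.symm_darts
    · exact this
  · exact (reach_of_mem (D := darts Cᶜ) (d := (g, true)) hgC).mono hmono

end RefOrientation
end Graph

/-! ### Cycles, minimal directed paths and directed cycles. -/

namespace Graph

variable {α β : Type*}

namespace RefOrientation

variable {G : Graph α β} {R : G.RefOrientation}

/-- An edge whose ends are not connected in `S` lies in a cut disjoint from `S`. -/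
lemma exists_isCut_of_not_reach [Finite V(G)] {S : Set E(G)} {e : E(G)}
    (h : ¬ R.Reach (darts S) (R.tail e) (R.head e)) :
    ∃ C, G.IsCut C ∧ e ∈ C ∧ Disjoint C S := by
  have he : (e, true) ∈ R.outDarts {v | R.Reach (darts S) (R.tail e) v} := ⟨.refl _, h⟩
  obtain ⟨X, heX, hX, hC⟩ := exists_isCut_outDarts_subset he
  refine ⟨_, hC, ⟨_, heX, rfl⟩, Set.disjoint_left.2 ?_⟩
  rintro _ ⟨d, hd, rfl⟩ hdS
  have hd' := hX hd
  exact hd'.2 (Reach.trans hd'.1 (reach_of_mem (D := darts S) hdS))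

/-- A set of edges is met by no cut in precisely one edge if and only if the ends of each of its
edges are connected by its other edges. -/
lemma forall_isCut_iff [Finite V(G)] {C : Set E(G)} :
    (∀ K, G.IsCut K → ¬ ∃ e, K ∩ C = {e}) ↔
      ∀ e ∈ C, R.Reach (darts (C \ {e})) (R.tail e) (R.head e) := by
  constructor
  · intro h e he
    by_contra hr
    obtain ⟨K, hK, heK, hd⟩ := exists_isCut_of_not_reach hr
    refine h K hK ⟨e, Set.eq_singleton_iff_unique_mem.2 ⟨⟨heK, he⟩, fun f hf => ?_⟩⟩
    by_contra hfe
    exact Set.disjoint_left.1 hd hf.1 ⟨hf.2, hfe⟩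
  · rintro h K hK ⟨e, he⟩
    have heKC : e ∈ K ∩ C := he ▸ rfl
    refine not_reach_compl_of_mem_cut (R := R) hK heKC.1 ((h e heKC.2).mono ?_)
    intro d hd hdK
    have : d.1 ∈ K ∩ C := ⟨hdK, hd.1⟩
    rw [he] at this
    exact hd.2 this

/-- A closed path without a superfluous edge is a cycle. -/
lemma isCycle_insert [Finite V(G)] {P : Set E(G)} {e : E(G)} (heP : e ∉ P)
    (h : R.Reach (darts P) (R.tail e) (R.head e))
    (hmin : ∀ f ∈ P, ¬ R.Reach (darts (P \ {f})) (R.tail e) (R.head e)) :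
    G.IsCycle (insert e P) := by
  rw [IsCycle, Set.minimal_iff_forall_ssubset]
  refine ⟨⟨Set.insert_nonempty e P, (forall_isCut_iff (R := R)).2 ?_⟩, ?_⟩
  · rintro f (rfl | hf)
    · refine h.mono ?_
      exact fun d hd => ⟨.inr hd, fun hdf => heP (hdf ▸ hd)⟩
    · by_contra hr
      have hfe : f ≠ e := fun hfe => heP (hfe ▸ hf)
      -- `K` meets the closed path only in `f`. The path between the ends of `e` must use `f`, so
      -- going round through `e` joins the ends of `f` off `K`, which is impossible.
      obtain ⟨K, hK, hfK, hd⟩ := exists_isCut_of_not_reach hr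
      have heK : e ∉ K := fun heK => Set.disjoint_left.1 hd heK ⟨.inl rfl, hfe.symm⟩
      have hsub : darts (P \ {f}) ⊆ darts (G := G) Kᶜ := fun a ha haK =>
        Set.disjoint_left.1 hd haK ⟨.inr ha.1, ha.2⟩
      have hins : darts P ⊆
          insert (f, true) (insert (f, !true) (darts (G := G) (P \ {f}))) := by
        intro a ha
        by_cases haf : a.1 = f
        · rcases a with ⟨a, _ | _⟩ <;> simp_all
        · exact .inr (.inr ⟨ha, haf⟩)
      have h1 := h.mono hins
      have hnot := hmin f hf
      have hes : R.Reach (darts Kᶜ) (R.tail e) (R.head e) :=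
        reach_of_mem (D := darts Kᶜ) (d := (e, true)) heK
      have hfs : R.Reach (darts Kᶜ) (R.tail f) (R.head f) := by
        rw [reach_insert, reach_insert, reach_insert, reach_insert] at h1
        simp only [source_not, target_not] at h1
        have e1 : R.source (f, true) = R.tail f := rfl
        have e2 : R.target (f, true) = R.head f := rfl
        rw [e1, e2] at h1
        have key : ∀ {x y x' y' : V(G)}, R.Reach (darts (P \ {f})) x y →
            R.Reach (darts (P \ {f})) x' y' → R.Reach (darts Kᶜ) x x' →
            R.Reach (darts Kᶜ) y y' := fun h h' hx =>
          ((h.mono hsub).symm_darts.trans hx).trans (h'.mono hsub)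
        rcases h1 with (h1 | ⟨h1, h2⟩) | ⟨h1 | ⟨h1, -⟩, h2 | ⟨-, h2⟩⟩
        · exact absurd h1 hnot
        · exact (key h1 h2.symm_darts hes).symm_darts
        · exact key h1 h2.symm_darts hes
        · exact absurd (h1.trans h2) hnot
        · exact absurd (h1.trans h2) hnot
        · exact (key h1 h2.symm_darts hes).symm_darts
      exact not_reach_compl_of_mem_cut (R := R) hK hfK hfs
  · rintro T hT ⟨⟨f, hf⟩, hcut⟩
    rw [forall_isCut_iff (R := R)] at hcut
    obtain ⟨g, hgC, hgT⟩ := Set.exists_of_ssubset hT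
    have hTP : ∀ a ∈ T, a ≠ e → a ∈ P := fun a ha hae => (hT.1 ha).resolve_left hae
    by_cases heT : e ∈ T
    · have hgP : g ∈ P := hgC.resolve_left fun h => hgT (h ▸ heT)
      refine hmin g hgP ((hcut e heT).mono ?_)
      refine fun a ha => ⟨hTP _ ha.1 ha.2, ?_⟩
      rintro rfl
      exact hgT ha.1
    · have hfP : f ∈ P := hTP f hf fun h => heT (h ▸ hf)
      refine hmin f hfP (h.of_forall_mem fun a ha => ?_)
      by_cases haf : a.1 = f
      · obtain ⟨a, δ⟩ := a
        subst haf
        refine reach_dart_of_reach δ ((hcut a hf).mono ?_)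
        refine fun b hb => ⟨hTP _ hb.1 ?_, hb.2⟩
        rintro rfl
        exact heT hb.1
      · exact reach_of_mem (D := darts (P \ {f})) ⟨ha, haf⟩

/-- A set of directed edges minimal among those that lead from `x` to `y`. -/
def IsMinimalReach (R : G.RefOrientation) (P : Set G.Dart) (x y : V(G)) : Prop :=
  Minimal (fun P => R.Reach P x y) P

namespace IsMinimalReach

variable {P : Set G.Dart} {x y : V(G)}

/-- The vertices reached from `x` without using `d`. -/
def before (R : G.RefOrientation) (P : Set G.Dart) (x : V(G)) (d : G.Dart) : Set V(G) :=
  {v | R.Reach (P \ {d}) x v}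

lemma mem_before_self (d : G.Dart) : x ∈ before R P x d := .refl x

lemma notMem_before (h : R.IsMinimalReach P x y) {d : G.Dart} (hd : d ∈ P) :
    y ∉ before R P x d :=
  Set.minimal_iff_forall_ssubset.1 h |>.2 (Set.sdiff_singleton_ssubset.2 hd)

lemma target_mem_before {d f : G.Dart} (hf : f ∈ P) (hne : f ≠ d)
    (hs : R.source f ∈ before R P x d) : R.target f ∈ before R P x d :=
  Reach.trans hs (reach_of_mem ⟨hf, hne⟩)

lemma mem_of_closed (h : R.IsMinimalReach P x y) (Y : Set V(G)) (hx : x ∈ Y)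
    (hY : ∀ d ∈ P, R.source d ∈ Y → R.target d ∈ Y) : y ∈ Y :=
  Reach.mem_of_closed h.prop Y hx hY

lemma crosses (h : R.IsMinimalReach P x y) {d : G.Dart} (hd : d ∈ P) :
    R.source d ∈ before R P x d ∧ R.target d ∉ before R P x d := by
  by_contra hc
  refine h.notMem_before hd (h.mem_of_closed _ (mem_before_self d) fun f hf hs => ?_)
  by_cases hfd : f = d
  · subst hfd
    by_contra hn
    exact hc ⟨hs, hn⟩
  · exact target_mem_before hf hfd hs

/-- If `f` entered the initial segment from outside, all of the segment, including the end of `f`,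
would be reached without `f`, and `f` would be superfluous. -/
lemma source_mem_before_of_target_mem (h : R.IsMinimalReach P x y) {d f : G.Dart}
    (hf : f ∈ P) (ht : R.target f ∈ before R P x d) : R.source f ∈ before R P x d := by
  by_contra hs
  have hsub : before R P x d ⊆ before R P x f := fun z hz => by
    have hz' : R.Reach (P \ {d}) x z := hz
    refine (hz'.mem_of_closed (before R P x d ∩ before R P x f)
      ⟨mem_before_self d, mem_before_self f⟩ ?_).2
    rintro g ⟨hg, hgd⟩ ⟨h1, h2⟩
    refine ⟨target_mem_before hg hgd h1, target_mem_before hg ?_ h2⟩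
    rintro rfl
    exact hs h1
  refine h.notMem_before hf (h.mem_of_closed _ (mem_before_self f) fun g hg hgs => ?_)
  by_cases hgf : g = f
  · subst hgf
    exact hsub ht
  · exact target_mem_before hg hgf hgs

lemma not_mem_of_not (h : R.IsMinimalReach P x y) {e : E(G)} {δ : Bool} (he : (e, δ) ∈ P) :
    (e, !δ) ∉ P := by
  intro he'
  have hc := h.crosses he
  have := h.source_mem_before_of_target_mem he' (by rw [target_not]; exact hc.1)
  rw [source_not] at this
  exact hc.2 this

/-- The initial segment before a dart is left by that dart only and entered by none, so its edge is
a bridge even when directions are ignored. This turns directed minimality into the undirected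
minimality that `isCycle_insert` needs. -/
lemma not_reach_sdiff (h : R.IsMinimalReach P x y) {f : E(G)} (hf : f ∈ Prod.fst '' P) :
    ¬ R.Reach (darts (Prod.fst '' P \ {f})) x y := by
  obtain ⟨d, hd, rfl⟩ := hf
  intro hr
  refine h.notMem_before hd (hr.mem_of_closed _ (mem_before_self d) ?_)
  rintro ⟨g, δ⟩ ⟨⟨⟨g', ε⟩, hg, rfl⟩, hgd⟩ hs
  have hne : (g', ε) ≠ d := fun h => hgd (by rw [← h]; rfl)
  by_cases hεδ : δ = ε
  · subst hεδ
    exact target_mem_before hg hne hs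
  · obtain rfl : δ = !ε := by cases δ <;> cases ε <;> simp_all
    rw [target_not]
    rw [source_not] at hs
    exact h.source_mem_before_of_target_mem hg hs

lemma eq_of_source_eq (h : R.IsMinimalReach P x y) {d f : G.Dart} (hd : d ∈ P) (hf : f ∈ P)
    (hdf : R.source d = R.source f) : d = f := by
  by_contra hne
  refine (h.mem_of_closed (before R P x d ∪ before R P x f) (.inl (mem_before_self d))
    fun g hg hs => ?_).elim (h.notMem_before hd) (h.notMem_before hf)
  by_cases hgd : g = d
  · subst hgd
    exact .inr (target_mem_before hg hne (hdf ▸ (h.crosses hf).1))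
  by_cases hgf : g = f
  · subst hgf
    exact .inl (target_mem_before hg hgd (hdf ▸ (h.crosses hd).1))
  exact hs.imp (target_mem_before hg hgd) (target_mem_before hg hgf)

lemma eq_of_target_eq (h : R.IsMinimalReach P x y) {d f : G.Dart} (hd : d ∈ P) (hf : f ∈ P)
    (hdf : R.target d = R.target f) : d = f := by
  by_contra hne
  refine h.notMem_before hd (h.mem_of_closed (before R P x d ∩ before R P x f)
    ⟨mem_before_self d, mem_before_self f⟩ fun g hg hs => ?_).1
  by_cases hgd : g = d
  · subst hgd
    exact absurd (target_mem_before hg hne hs.2) (hdf ▸ (h.crosses hf).2)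
  by_cases hgf : g = f
  · subst hgf
    exact absurd (target_mem_before hg hgd hs.1) (hdf ▸ (h.crosses hd).2)
  exact ⟨target_mem_before hg hgd hs.1, target_mem_before hg hgf hs.2⟩

lemma target_ne (h : R.IsMinimalReach P x y) {d : G.Dart} (hd : d ∈ P) : R.target d ≠ x :=
  fun hx => (h.crosses hd).2 (hx ▸ mem_before_self d)

lemma source_ne (h : R.IsMinimalReach P x y) {d : G.Dart} (hd : d ∈ P) : R.source d ≠ y :=
  fun hy => h.notMem_before hd (hy ▸ (h.crosses hd).1)

lemma exists_source_eq_target (h : R.IsMinimalReach P x y) {d : G.Dart} (hd : d ∈ P)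
    (hy : R.target d ≠ y) : ∃ f ∈ P, R.source f = R.target d := by
  by_contra! hc
  refine (h.mem_of_closed (insert (R.target d) (before R P x d)) (.inr (mem_before_self d))
    fun g hg hs => ?_).elim (fun h => hy h.symm) (h.notMem_before hd)
  by_cases hgd : g = d
  · subst hgd
    exact .inl rfl
  · exact .inr (target_mem_before hg hgd (hs.resolve_left (hc g hg)))

lemma exists_target_eq_source (h : R.IsMinimalReach P x y) {d : G.Dart} (hd : d ∈ P)
    (hx : R.source d ≠ x) : ∃ f ∈ P, R.target f = R.source d := by
  by_contra! hc
  refine h.notMem_before hd (h.mem_of_closed (before R P x d \ {R.source d})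
    ⟨mem_before_self d, fun h => hx h.symm⟩ fun g hg hs => ⟨?_, hc g hg⟩).1
  refine target_mem_before hg ?_ hs.1
  rintro rfl
  exact hs.2 rfl

lemma exists_source_eq (h : R.IsMinimalReach P x y) (hxy : x ≠ y) : ∃ d ∈ P, R.source d = x := by
  by_contra! hc
  exact hxy (h.mem_of_closed {x} rfl fun g hg hs => absurd hs (hc g hg)).symm

lemma exists_target_eq (h : R.IsMinimalReach P x y) (hxy : x ≠ y) : ∃ d ∈ P, R.target d = y := by
  by_contra! hc
  exact h.mem_of_closed {y}ᶜ hxy (fun g hg _ => hc g hg) rfl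

/-- Closing up a minimal directed path by a directed edge gives a directed cycle. -/
lemma isDirectedCycle_insert [Finite V(G)] {e : E(G)} {δ : Bool}
    (h : R.IsMinimalReach P (R.target (e, δ)) (R.source (e, δ))) (he : e ∉ Prod.fst '' P) :
    R.IsDirectedCycle (insert (e, δ) P) := by
  have heP : ∀ ε, (e, ε) ∉ P := fun ε hε => he ⟨_, hε, rfl⟩
  refine ⟨?_, ?_, fun v => ?_⟩
  · have hPd : P ⊆ darts (Prod.fst '' P) := fun d hd => ⟨d, hd, rfl⟩
    have hr := (show R.Reach P _ _ from h.prop).mono hPd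
    have hm := fun f hf => h.not_reach_sdiff (f := f) hf
    rw [Set.image_insert_eq]
    refine isCycle_insert (R := R) he ?_ fun f hf hr' => hm f hf ?_
    · cases δ
      · exact hr
      · exact hr.symm_darts
    · cases δ
      · exact hr'
      · exact hr'.symm_darts
  · rintro f ⟨h1, h2⟩
    rcases h1 with h1 | h1 <;> rcases h2 with h2 | h2
    · simpa using h1.trans h2.symm
    · cases h1
      exact heP _ h2
    · cases h2
      exact heP _ h1
    · exact h.not_mem_of_not h1 h2
  -- Balance holds because each vertex is entered at most once, left at most once, and entered
  -- exactly when it is left.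
  · have hin : {d | d ∈ insert (e, δ) P ∧ R.target d = v}.Subsingleton := by
      rintro a ⟨rfl | ha, hav⟩ b ⟨rfl | hb, hbv⟩
      · rfl
      · exact absurd (hbv.trans hav.symm) (h.target_ne hb)
      · exact absurd (hav.trans hbv.symm) (h.target_ne ha)
      · exact h.eq_of_target_eq ha hb (hav.trans hbv.symm)
    have hout : {d | d ∈ insert (e, δ) P ∧ R.source d = v}.Subsingleton := by
      rintro a ⟨rfl | ha, hav⟩ b ⟨rfl | hb, hbv⟩
      · rfl
      · exact absurd (hbv.trans hav.symm) (h.source_ne hb)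
      · exact absurd (hav.trans hbv.symm) (h.source_ne ha)
      · exact h.eq_of_source_eq ha hb (hav.trans hbv.symm)
    have hiff : {d | d ∈ insert (e, δ) P ∧ R.target d = v}.Nonempty ↔
        {d | d ∈ insert (e, δ) P ∧ R.source d = v}.Nonempty := by
      constructor
      · rintro ⟨a, rfl | ha, rfl⟩
        · by_cases hxy : R.target (e, δ) = R.source (e, δ)
          · exact ⟨_, .inl rfl, hxy.symm⟩
          · obtain ⟨d, hd, hdx⟩ := h.exists_source_eq hxy
            exact ⟨d, .inr hd, hdx⟩
        · by_cases hy : R.target a = R.source (e, δ)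
          · exact ⟨_, .inl rfl, hy.symm⟩
          · obtain ⟨d, hd, hdx⟩ := h.exists_source_eq_target ha hy
            exact ⟨d, .inr hd, hdx⟩
      · rintro ⟨a, rfl | ha, rfl⟩
        · by_cases hxy : R.target (e, δ) = R.source (e, δ)
          · exact ⟨_, .inl rfl, hxy⟩
          · obtain ⟨d, hd, hdx⟩ := h.exists_target_eq hxy
            exact ⟨d, .inr hd, hdx⟩
        · by_cases hx : R.source a = R.target (e, δ)
          · exact ⟨_, .inl rfl, hx.symm⟩
          · obtain ⟨d, hd, hdx⟩ := h.exists_target_eq_source ha hx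
            exact ⟨d, .inr hd, hdx⟩
    rcases hin.eq_empty_or_singleton with h1 | ⟨a, h1⟩ <;>
      rcases hout.eq_empty_or_singleton with h2 | ⟨b, h2⟩
    · rw [h1, h2]
    · rw [h1, h2] at hiff
      simp at hiff
    · rw [h1, h2] at hiff
      simp at hiff
    · rw [h1, h2, Set.ncard_singleton, Set.ncard_singleton]

end IsMinimalReach

/-- In a balanced set of directed edges, the others lead from the end of one of them back to its
start. -/
lemma reach_sdiff_of_balanced [Finite V(G)] [Finite E(G)] {D : Set G.Dart}
    (hD : ∀ v, {d | d ∈ D ∧ R.target d = v}.ncard = {d | d ∈ D ∧ R.source d = v}.ncard)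
    {d : G.Dart} (hd : d ∈ D) : R.Reach (D \ {d}) (R.target d) (R.source d) := by
  classical
  by_contra hr
  have := Fintype.ofFinite V(G)
  have := Fintype.ofFinite G.Dart
  set Y : Set V(G) := {v | R.Reach (D \ {d}) (R.target d) v} with hY
  have hcount : ∀ g : G.Dart → V(G), {f | f ∈ D ∧ g f ∈ Y}.ncard =
      ∑ v ∈ Finset.univ.filter (· ∈ Y), {f | f ∈ D ∧ g f = v}.ncard := by
    intro g
    rw [Set.ncard_eq_toFinset_card', Finset.card_eq_sum_card_fiberwise (f := g)
      (t := Finset.univ.filter (· ∈ Y))]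
    · refine Finset.sum_congr rfl fun v hv => ?_
      rw [Set.ncard_eq_toFinset_card']
      congr 1
      ext f
      simp only [Finset.mem_filter, Set.mem_toFinset, Set.mem_ofPred_eq, Finset.mem_univ,
        true_and] at hv ⊢
      constructor
      · rintro ⟨⟨h1, -⟩, h2⟩
        exact ⟨h1, h2⟩
      · rintro ⟨h1, rfl⟩
        exact ⟨⟨h1, hv⟩, rfl⟩
    · intro f hf
      simpa using (show f ∈ D ∧ g f ∈ Y by simpa using hf).2
  -- No dart of `D` leaves `Y`, while `d` enters it; summing the balance over `Y` forbids this.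
  have hlt : {f | f ∈ D ∧ R.source f ∈ Y} ⊂ {f | f ∈ D ∧ R.target f ∈ Y} := by
    refine Set.ssubset_iff_of_subset ?_ |>.2 ⟨d, ⟨hd, .refl _⟩, fun h => hr h.2⟩
    rintro f ⟨hf, hs⟩
    refine ⟨hf, Reach.trans hs (reach_of_mem ⟨hf, ?_⟩)⟩
    rintro rfl
    exact hr hs
  refine (Set.ncard_lt_ncard hlt (Set.toFinite _)).ne ?_
  rw [hcount, hcount]
  exact Finset.sum_congr rfl fun v _ => (hD v).symm

/-! ### Test directions and admissible tests. -/

/-- The direction in which the activity of `e` is tested. -/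
noncomputable def testSign (σu σb : E(G) → Bool) (O : G.Fourientation) (e : E(G)) : Bool :=
  open Classical in
  if e ∈ O.unoriented then σu e else if e ∈ O.bioriented then !σb e else decide ((e, true) ∈ O)

variable {σu σb : E(G) → Bool}

lemma mem_oriented_iff {O : G.Fourientation} {e : E(G)} :
    e ∈ O.oriented ↔ ∃ δ, (e, δ) ∈ O ∧ (e, !δ) ∉ O := by
  simp only [Fourientation.oriented, Fourientation.unoriented, Fourientation.bioriented,
    Set.mem_ofPred_eq, Bool.exists_bool, Bool.not_true, Bool.not_false]
  tauto

lemma testSign_of_oriented {O : G.Fourientation} {e : E(G)} {δ : Bool} (h : (e, δ) ∈ O)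
    (h' : (e, !δ) ∉ O) : testSign σu σb O e = δ := by
  cases δ <;>
    simp_all [testSign, Fourientation.unoriented, Fourientation.bioriented]

lemma testSign_of_unoriented {O : G.Fourientation} {e : E(G)} (h : e ∈ O.unoriented) :
    testSign σu σb O e = σu e := by
  simp [testSign, h]

lemma testSign_of_bioriented {O : G.Fourientation} {e : E(G)} (h : e ∈ O.bioriented) :
    testSign σu σb O e = !σb e := by
  have : e ∉ O.unoriented := fun h' => h'.1 h.1
  simp [testSign, h, this]

lemma testSign_congr {O O' : G.Fourientation} {e : E(G)}
    (h : ∀ δ, (e, δ) ∈ O ↔ (e, δ) ∈ O') : testSign σu σb O e = testSign σu σb O' e := by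
  have hu : e ∈ O.unoriented ↔ e ∈ O'.unoriented := by simp [Fourientation.unoriented, h]
  have hb : e ∈ O.bioriented ↔ e ∈ O'.bioriented := by simp [Fourientation.bioriented, h]
  unfold testSign
  split_ifs <;> simp_all

/-- `e` may be tested for cut activity (if `k` is true) or for cycle activity (otherwise). -/
def Admissible (k : Bool) (O : G.Fourientation) (e : E(G)) : Prop :=
  (k = true → e ∉ O.bioriented) ∧ (k = false → e ∉ O.unoriented)

lemma admissible_congr {k : Bool} {O O' : G.Fourientation} {e : E(G)}
    (h : ∀ δ, (e, δ) ∈ O ↔ (e, δ) ∈ O') : Admissible k O e ↔ Admissible k O' e := by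
  simp [Admissible, Fourientation.unoriented, Fourientation.bioriented, h]

lemma Admissible.eq_testSign_of_mem {O : G.Fourientation} {e : E(G)} {δ : Bool}
    (h : Admissible true O e) (hδ : (e, δ) ∈ O) : δ = testSign σu σb O e := by
  have hb := h.1 rfl
  refine (testSign_of_oriented hδ fun hδ' => hb ?_).symm
  cases δ
  exacts [⟨hδ', hδ⟩, ⟨hδ, hδ'⟩]

lemma Admissible.testSign_mem {O : G.Fourientation} {e : E(G)} (h : Admissible false O e) :
    (e, testSign σu σb O e) ∈ O := by
  by_cases hb : e ∈ O.bioriented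
  · cases testSign σu σb O e
    exacts [hb.2, hb.1]
  · obtain ⟨δ, h1, h2⟩ := mem_oriented_iff.1 ⟨h.2 rfl, hb⟩
    rwa [testSign_of_oriented h1 h2]

lemma eq_insert_insert_of_bioriented {N M : G.Fourientation} {m : E(G)} (δ : Bool)
    (h : ∀ d, d ∈ M ↔ d ∈ N ∨ d.1 = m) : M = insert (m, !δ) (insert (m, δ) N) := by
  ext ⟨f, ε⟩
  simp only [h, Set.mem_insert_iff, Prod.mk.injEq]
  cases ε <;> cases δ <;> simp <;> tauto

lemma eq_insert_of_oriented {O N M : G.Fourientation} {m : E(G)} {δ : Bool} (h1 : (m, δ) ∈ O)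
    (h2 : (m, !δ) ∉ O) (h : ∀ d, d ∈ M ↔ d ∈ N ∨ (d.1 = m ∧ d ∈ O)) : M = insert (m, δ) N := by
  ext ⟨f, ε⟩
  simp only [h, Set.mem_insert_iff, Prod.mk.injEq]
  have : f = m → ((f, ε) ∈ O ↔ ε = δ) := by
    rintro rfl
    cases ε <;> cases δ <;> simp_all
  tauto

lemma reach_tail_head_iff {T : Set E(G)} {e : E(G)} (δ : Bool) :
    R.Reach (darts T) (R.target (e, δ)) (R.source (e, δ)) ↔
      R.Reach (darts T) (R.tail e) (R.head e) := by
  cases δ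
  · exact Iff.rfl
  · exact ⟨fun h => h.symm_darts, fun h => h.symm_darts⟩

end RefOrientation
end Graph

namespace Graph

variable {α β : Type*}

namespace RefOrientation

variable {G : Graph α β} {R : G.RefOrientation} [LinearOrder E(G)]

/-! ### Activities and reachability -/

/-- The directed edges of `O` above `e`, together with all directions of the edges below `e` if
`k` is true. -/
def window (k : Bool) (O : G.Fourientation) (e : E(G)) : Set G.Dart :=
  {d | (d ∈ O ∧ e < d.1) ∨ (k = true ∧ d.1 < e)}

@[simp] lemma mem_window {k : Bool} {O : G.Fourientation} {e : E(G)} {d : G.Dart} :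
    d ∈ window k O e ↔ (d ∈ O ∧ e < d.1) ∨ (k = true ∧ d.1 < e) := Iff.rfl

lemma window_darts (k : Bool) (S : Set E(G)) (e : E(G)) :
    window k (darts S) e = darts {f | (f ∈ S ∧ e < f) ∨ (k = true ∧ f < e)} := rfl

lemma mem_genCutActive_iff [Finite V(G)] {S : G.SpanningSubgraph} {e : E(G)} :
    e ∈ G.genCutActive S ↔ ¬ R.Reach (window true (darts S) e) (R.tail e) (R.head e) := by
  rw [window_darts]
  constructor
  · rintro ⟨C, hC, hdisj, heC, hmin⟩ h
    refine not_reach_compl_of_mem_cut (R := R) hC heC (h.mono ?_)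
    rintro d (⟨hd, hlt⟩ | ⟨-, hlt⟩) hdC
    · have : d.1 ∈ C ∩ (S \ {e}) := ⟨hdC, hd, hlt.ne'⟩
      rw [hdisj] at this
      exact this
    · exact (hmin hdC).not_gt hlt
  · intro h
    obtain ⟨C, hC, heC, hd⟩ := exists_isCut_of_not_reach h
    rw [Set.disjoint_left] at hd
    refine ⟨C, hC, Set.eq_empty_of_forall_notMem ?_, heC, fun f hf => ?_⟩
    · rintro f ⟨hf, hfS, hfe⟩
      rcases lt_or_gt_of_ne hfe with hlt | hlt
      · exact hd hf (.inr ⟨rfl, hlt⟩)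
      · exact hd hf (.inl ⟨hfS, hlt⟩)
    · by_contra hlt
      exact hd hf (.inr ⟨rfl, not_le.1 hlt⟩)

lemma mem_genCycleActive_iff [Finite V(G)] [Finite E(G)] {S : G.SpanningSubgraph} {e : E(G)} :
    e ∈ G.genCycleActive S ↔ R.Reach (window false (darts S) e) (R.tail e) (R.head e) := by
  rw [window_darts]
  constructor
  · rintro ⟨C, hC, hCS, heC, hmin⟩
    refine ((forall_isCut_iff (R := R)).1 hC.prop.2 e heC).mono ?_
    rintro d ⟨hd, hde⟩
    exact .inl ⟨(hCS hd).resolve_right hde, lt_of_le_of_ne (hmin hd) (Ne.symm hde)⟩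
  · intro h
    obtain ⟨P, hPS, hP⟩ := exists_minimal_le_of_wellFoundedLT
      (fun P : Set E(G) => R.Reach (darts P) (R.tail e) (R.head e)) _ h
    have hPe : ∀ f ∈ P, f ∈ S ∧ e < f := fun f hf => by simpa using hPS hf
    refine ⟨insert e P, isCycle_insert (R := R) (fun he => (hPe e he).2.ne rfl) hP.prop
      fun f hf => (Set.minimal_iff_forall_ssubset.1 hP).2 (Set.sdiff_singleton_ssubset.2 hf),
      ?_, Set.mem_insert e P, ?_⟩
    · rintro f (rfl | hf)
      · exact .inr rfl
      · exact .inl (hPe f hf).1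
    · rintro f (rfl | hf)
      · exact le_rfl
      · exact (hPe f hf).2.le

/-- A potential cut with minimum `e` is crossed backwards by no dart of the window. Conversely, the
vertices not reached from the end of `e` are entered by no such dart, and the directed edges out of
them contain a directed cut through `e`. -/
lemma isMinOfPotentialCut_iff [Finite V(G)] {O : G.Fourientation} {e : E(G)} :
    R.IsMinOfPotentialCut O e ↔ ∃ δ, (e, !δ) ∉ O ∧
      ¬ R.Reach (window true O e) (R.target (e, δ)) (R.source (e, δ)) := by
  constructor
  · rintro ⟨D, ⟨⟨-, X, rfl⟩, hO⟩, ⟨⟨e, δ⟩, he, rfl⟩, hmin⟩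
    refine ⟨δ, hO e δ he, fun hr => ?_⟩
    refine hr.mem_of_closed Xᶜ he.2 (fun d hd hs ht => ?_) he.1
    have hmem : (d.1, !d.2) ∈ R.outDarts X :=
      ⟨by rw [source_not]; simpa using ht, by rw [target_not]; exact hs⟩
    rcases hd with ⟨hd, -⟩ | ⟨-, hd⟩
    · have := hO _ _ hmem
      rw [Bool.not_not] at this
      exact this hd
    · exact (hmin ⟨_, hmem, rfl⟩).not_gt hd
  · rintro ⟨δ, heO, hr⟩
    set X₀ : Set V(G) := {v | ¬ R.Reach (window true O e) (R.target (e, δ)) v} with hX₀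
    have he : (e, δ) ∈ R.outDarts X₀ := ⟨hr, fun h => h (.refl _)⟩
    obtain ⟨X, heX, hX, hC⟩ := exists_isCut_outDarts_subset he
    have hwin : ∀ f ε, (f, ε) ∈ R.outDarts X → (f, !ε) ∉ window true O e := by
      intro f ε hf hw
      have hf' := hX hf
      have h2 : R.Reach (window true O e) (R.target (e, δ)) (R.target (f, ε)) := by
        by_contra hc
        exact hf'.2 hc
      have h3 := reach_of_mem (R := R) hw
      rw [source_not, target_not] at h3
      exact hf'.1 (h2.trans h3)
    have hle : ∀ f ε, (f, ε) ∈ R.outDarts X → e ≤ f := fun f ε hf => by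
      by_contra hlt
      exact hwin f ε hf (.inr ⟨rfl, not_le.1 hlt⟩)
    refine ⟨R.outDarts X, ⟨⟨hC, X, rfl⟩, fun f ε hf hfO => ?_⟩, ⟨_, heX, rfl⟩, ?_⟩
    · rcases (hle f ε hf).eq_or_lt with rfl | hlt
      · by_cases hεδ : ε = δ
        · exact heO (hεδ ▸ hfO)
        · obtain rfl : ε = !δ := by cases ε <;> cases δ <;> simp_all
          have h1 := heX.1
          have h2 := hf.2
          rw [target_not] at h2
          exact h2 h1
      · exact hwin f ε hf (.inl ⟨hfO, hlt⟩)
    · rintro _ ⟨⟨f, ε⟩, hf, rfl⟩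
      exact hle f ε hf

/-- Balance turns a directed cycle into a return path for `e`; a minimal return path closes up to a
directed cycle. -/
lemma isMinOfPotentialCycle_iff [Finite V(G)] [Finite E(G)] {O : G.Fourientation} {e : E(G)} :
    R.IsMinOfPotentialCycle O e ↔ ∃ δ, (e, δ) ∈ O ∧
      R.Reach (window false O e) (R.target (e, δ)) (R.source (e, δ)) := by
  constructor
  · rintro ⟨D, ⟨⟨-, hone, hbal⟩, hO⟩, ⟨⟨e, δ⟩, he, rfl⟩, hmin⟩
    refine ⟨δ, hO e δ he, (reach_sdiff_of_balanced hbal he).mono ?_⟩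
    rintro ⟨f, ε⟩ ⟨hf, hne⟩
    refine .inl ⟨hO f ε hf, lt_of_le_of_ne (hmin ⟨_, hf, rfl⟩) ?_⟩
    rintro rfl
    cases ε <;> cases δ
    · exact hne rfl
    · exact hone _ ⟨he, hf⟩
    · exact hone _ ⟨hf, he⟩
    · exact hne rfl
  · rintro ⟨δ, heO, hr⟩
    obtain ⟨P, hPO, hP⟩ := exists_minimal_le_of_wellFoundedLT
      (fun P : Set G.Dart => R.Reach P (R.target (e, δ)) (R.source (e, δ))) _ hr
    have hPe : ∀ d ∈ P, d ∈ O ∧ e < d.1 := fun d hd => by simpa using hPO hd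
    refine ⟨insert (e, δ) P, ⟨IsMinimalReach.isDirectedCycle_insert hP ?_, ?_⟩,
      ⟨_, .inl rfl, rfl⟩, ?_⟩
    · rintro ⟨d, hd, hde⟩
      exact (hPe d hd).2.ne hde.symm
    · rintro f ε (h | h)
      · exact h ▸ heO
      · exact (hPe _ h).1
    · rintro _ ⟨d, rfl | hd, rfl⟩
      · exact le_rfl
      · exact (hPe d hd).2.le

/-- The end of `e` is joined to its start by the directed edges of the window at `e`, where `e` is
directed by its test direction. -/
def Returns (R : G.RefOrientation) (σu σb : E(G) → Bool) (k : Bool) (O : G.Fourientation)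
    (e : E(G)) : Prop :=
  R.Reach (window k O e) (R.target (e, testSign σu σb O e)) (R.source (e, testSign σu σb O e))

variable {σu σb : E(G) → Bool}

lemma window_congr {k : Bool} {O O' : G.Fourientation} {e : E(G)}
    (h : ∀ d : G.Dart, e < d.1 → (d ∈ O ↔ d ∈ O')) : window k O e = window k O' e := by
  ext d
  simp only [mem_window]
  have := h d
  tauto

lemma cutActiveOriented_iff [Finite V(G)] {O : G.Fourientation} {e : E(G)} :
    e ∈ R.cutActiveOriented O ↔ e ∈ O.oriented ∧ ¬ R.Returns σu σb true O e := by
  refine and_congr_right fun he => ?_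
  obtain ⟨δ, h, h'⟩ := mem_oriented_iff.1 he
  rw [isMinOfPotentialCut_iff, Returns, testSign_of_oriented h h']
  constructor
  · rintro ⟨ε, hε, hr⟩
    by_cases hεδ : ε = δ
    · exact hεδ ▸ hr
    · obtain rfl : δ = !ε := by cases ε <;> cases δ <;> simp_all
      exact absurd h hε
  · exact fun hr => ⟨δ, h', hr⟩

lemma cycleActiveOriented_iff [Finite V(G)] [Finite E(G)] {O : G.Fourientation} {e : E(G)} :
    e ∈ R.cycleActiveOriented O ↔ e ∈ O.oriented ∧ R.Returns σu σb false O e := by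
  refine and_congr_right fun he => ?_
  obtain ⟨δ, h, h'⟩ := mem_oriented_iff.1 he
  rw [isMinOfPotentialCycle_iff, Returns, testSign_of_oriented h h']
  constructor
  · rintro ⟨ε, hε, hr⟩
    by_cases hεδ : ε = δ
    · exact hεδ ▸ hr
    · obtain rfl : ε = !δ := by cases ε <;> cases δ <;> simp_all
      exact absurd hε h'
  · exact fun hr => ⟨δ, h, hr⟩

lemma cutActiveUnoriented_iff [Finite V(G)] {O : G.Fourientation} {e : E(G)} :
    e ∈ R.cutActiveUnoriented σu O ↔ e ∈ O.unoriented ∧ ¬ R.Returns σu σb true O e := by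
  refine and_congr_right fun he => ?_
  have hw : window true (O ∪ {(e, σu e)}) e = window true O e := window_congr fun d hd => by
    have : d ≠ (e, σu e) := fun h => hd.ne (by rw [h])
    simp [this]
  have hnot : ∀ δ, (e, δ) ∉ O := fun δ => by cases δ; exacts [he.2, he.1]
  rw [isMinOfPotentialCut_iff, Returns, testSign_of_unoriented he, hw]
  constructor
  · rintro ⟨ε, hε, hr⟩
    obtain rfl : ε = σu e := by
      by_contra hne
      refine hε (.inr ?_)
      revert hne
      cases ε <;> cases h : σu e <;> simp
    exact hr
  · refine fun hr => ⟨σu e, ?_, hr⟩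
    rintro (h | h)
    · exact hnot _ h
    · simp at h

lemma cycleActiveBioriented_iff [Finite V(G)] [Finite E(G)] {O : G.Fourientation} {e : E(G)} :
    e ∈ R.cycleActiveBioriented σb O ↔ e ∈ O.bioriented ∧ R.Returns σu σb false O e := by
  refine and_congr_right fun he => ?_
  have hw : window false (O \ {(e, σb e)}) e = window false O e := window_congr fun d hd => by
    have : d ≠ (e, σb e) := fun h => hd.ne (by rw [h])
    simp [this]
  have hall : ∀ δ, (e, δ) ∈ O := fun δ => by cases δ; exacts [he.2, he.1]
  rw [isMinOfPotentialCycle_iff, Returns, testSign_of_bioriented he, hw]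
  constructor
  · rintro ⟨ε, hε, hr⟩
    obtain rfl : ε = !σb e := by
      by_contra hne
      refine hε.2 ?_
      revert hne
      cases ε <;> cases h : σb e <;> simp
    exact hr
  · refine fun hr => ⟨!σb e, ⟨hall _, ?_⟩, hr⟩
    simp

end RefOrientation
end Graph

namespace Graph

variable {α β : Type*}

namespace RefOrientation

variable {G : Graph α β} {R : G.RefOrientation} [LinearOrder E(G)] {σu σb : E(G) → Bool}

/-! ### Replacing oriented edges -/

/-- Adding the direction `δ` of `m` changes one of the activities below `m`. -/
def Gains (R : G.RefOrientation) (σu σb : E(G) → Bool) (N : G.Fourientation) (m : E(G))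
    (δ : Bool) : Prop :=
  ∃ k, ∃ e < m, Admissible k N e ∧ ¬ R.Returns σu σb k N e ∧
    R.Reach (window k N e) (R.target (e, testSign σu σb N e)) (R.source (m, δ)) ∧
    R.Reach (window k N e) (R.target (m, δ)) (R.source (e, testSign σu σb N e))

/-- If `i` gains by a dart from `p` to `q` and `j` by its reverse, the four paths form a closed walk
through the test darts of `i` and `j`. The hypothesis `hij` says which window absorbs the other one
and the test dart of `j`, up to the test dart of `i`. -/
lemma returns_of_reach_of_nested {N : G.Fourientation} {k l : Bool} {i j : E(G)} {p q : V(G)}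
    (hk : Admissible k N i) (hl : Admissible l N j)
    (hij : (k = true ∧ j < i) ∨ (l = false ∧ i < j))
    (h1 : R.Reach (window k N i) (R.target (i, testSign σu σb N i)) p)
    (h2 : R.Reach (window k N i) q (R.source (i, testSign σu σb N i)))
    (h3 : R.Reach (window l N j) (R.target (j, testSign σu σb N j)) q)
    (h4 : R.Reach (window l N j) p (R.source (j, testSign σu σb N j))) :
    R.Returns σu σb k N i := by
  set W := insert (i, testSign σu σb N i) (window k N i) with hW
  have hWsub : window k N i ⊆ W := Set.subset_insert _ _
  have hsub : window l N j ⊆ W := by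
    rintro d (⟨hd, hjd⟩ | ⟨rfl, hdj⟩)
    · rcases hij with ⟨rfl, hji⟩ | ⟨-, hij⟩
      · rcases lt_trichotomy d.1 i with h | h | h
        · exact .inr (.inr ⟨rfl, h⟩)
        · subst h
          exact .inl (Prod.ext rfl (hk.eq_testSign_of_mem hd))
        · exact .inr (.inl ⟨hd, h⟩)
      · exact .inr (.inl ⟨hd, hij.trans hjd⟩)
    · rcases hij with ⟨rfl, hji⟩ | ⟨h, -⟩
      · exact .inr (.inr ⟨rfl, hdj.trans hji⟩)
      · simp at h
  have hmem : (j, testSign σu σb N j) ∈ W := by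
    rcases hij with ⟨rfl, hji⟩ | ⟨rfl, hij⟩
    · exact .inr (.inr ⟨rfl, hji⟩)
    · exact .inr (.inl ⟨hl.testSign_mem, hij⟩)
  have key := (h1.mono hWsub).trans ((h4.mono hsub).trans
    ((reach_of_mem hmem).trans ((h3.mono hsub).trans (h2.mono hWsub))))
  -- Stop the walk at its first arrival at the start of `i`: up to there the test dart of `i` is not
  -- used.
  rw [hW, reach_insert] at key
  exact key.elim id fun h => h.1

lemma window_false_subset (k : Bool) (N : G.Fourientation) (e : E(G)) :
    window false N e ⊆ window k N e := by
  rintro d (hd | ⟨h, -⟩)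
  · exact .inl hd
  · simp at h

/-- The test of the larger edge decides: a cut test there makes the larger edge return, a cycle test
the smaller one. For equal edges the windows are nested and the paths join at an end of `m`. -/
lemma not_gains_not {N : G.Fourientation} {m : E(G)} {δ : Bool} (h : R.Gains σu σb N m δ) :
    ¬ R.Gains σu σb N m (!δ) := by
  obtain ⟨k, i, -, hk, hi, h1, h2⟩ := h
  rintro ⟨l, j, -, hl, hj, h3, h4⟩
  rw [source_not] at h3
  rw [target_not] at h4
  rcases lt_trichotomy i j with hij | rfl | hij
  · cases l
    · exact hi (returns_of_reach_of_nested hk hl (.inr ⟨rfl, hij⟩) h1 h2 h3 h4)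
    · exact hj (returns_of_reach_of_nested hl hk (.inl ⟨rfl, hij⟩) h3 h4 h1 h2)
  · have hkl : window k N i ⊆ window l N i ∨ window l N i ⊆ window k N i := by
      cases k
      · exact .inl (window_false_subset _ _ _)
      · cases l
        · exact .inr (window_false_subset _ _ _)
        · exact .inl subset_rfl
    rcases hkl with hkl | hkl
    · exact hj (h3.trans (h2.mono hkl))
    · exact hi ((h3.mono hkl).trans h2)
  · cases k
    · exact hj (returns_of_reach_of_nested hl hk (.inr ⟨rfl, hij⟩) h3 h4 h1 h2)
    · exact hi (returns_of_reach_of_nested hk hl (.inl ⟨rfl, hij⟩) h1 h2 h3 h4)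

lemma window_insert {N : G.Fourientation} {k : Bool} {e m : E(G)} (h : e < m) (δ : Bool) :
    window k (insert (m, δ) N) e = insert (m, δ) (window k N e) := by
  ext d
  simp only [mem_window, Set.mem_insert_iff]
  constructor
  · tauto
  · rintro (rfl | h)
    · exact .inl ⟨.inl rfl, h⟩
    · tauto

lemma mem_insert_dart_iff {N : G.Fourientation} {e m : E(G)} (h : e < m) (δ ε : Bool) :
    (e, ε) ∈ insert (m, δ) N ↔ (e, ε) ∈ N := by
  simp [h.ne]

lemma returns_insert_iff {N : G.Fourientation} {k δ : Bool} {e m : E(G)} (h : e < m) :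
    R.Returns σu σb k (insert (m, δ) N) e ↔ R.Returns σu σb k N e ∨
      (R.Reach (window k N e) (R.target (e, testSign σu σb N e)) (R.source (m, δ)) ∧
      R.Reach (window k N e) (R.target (m, δ)) (R.source (e, testSign σu σb N e))) := by
  rw [Returns, testSign_congr (mem_insert_dart_iff h δ), window_insert h, reach_insert, Returns]

lemma returns_insert_of_not_gains {N : G.Fourientation} {k δ : Bool} {e m : E(G)} (h : e < m)
    (hk : Admissible k N e) (hg : ¬ R.Gains σu σb N m δ) :
    R.Returns σu σb k (insert (m, δ) N) e ↔ R.Returns σu σb k N e := by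
  rw [returns_insert_iff h, or_iff_left_iff_imp]
  intro h'
  by_contra hr
  exact hg ⟨k, e, h, hk, hr, h'⟩

lemma returns_insert_insert_of_not_gains {N : G.Fourientation} {k δ : Bool} {e m : E(G)}
    (h : e < m) (hk : Admissible k N e) (hg : ¬ R.Gains σu σb N m (!δ)) :
    R.Returns σu σb k (insert (m, !δ) (insert (m, δ) N)) e ↔
      R.Returns σu σb k (insert (m, δ) N) e := by
  rw [returns_insert_iff h, or_iff_left_iff_imp, testSign_congr (mem_insert_dart_iff h δ),
    window_insert h, reach_insert, reach_insert, returns_insert_iff h]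
  have hg' : R.Reach (window k N e) (R.target (e, testSign σu σb N e)) (R.target (m, δ)) →
      R.Reach (window k N e) (R.source (m, δ)) (R.source (e, testSign σu σb N e)) →
      R.Returns σu σb k N e := by
    intro h1 h2
    by_contra hr
    exact hg ⟨k, e, h, hk, hr, by rwa [source_not], by rwa [target_not]⟩
  simp only [source_not, target_not]
  rintro ⟨h1 | ⟨h1, -⟩, h2 | ⟨-, h2⟩⟩
  · exact .inl (hg' h1 h2)
  · exact .inl (h1.trans h2)
  · exact .inl (h1.trans h2)
  · exact .inr ⟨h1, h2⟩

/-- The oriented edge `m` is to be kept if it is directed positively. -/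
def KeepsPositive (R : G.RefOrientation) (σu σb : E(G) → Bool) (N : G.Fourientation)
    (m : E(G)) : Prop :=
  R.Gains σu σb N m true ∨
    -- The tie-break if neither direction gains: the positive direction is kept unless `m` is cycle
    -- active, as the sign conditions demand.
    (¬ R.Gains σu σb N m false ∧ ¬ R.Reach (window false N m) (R.tail m) (R.head m))

/-- The edges in `U` are bioriented or unoriented according to `S`, the others as in `O`. -/
def replaceOn (O : G.Fourientation) (S U : Set E(G)) : G.Fourientation :=
  {d | (d.1 ∈ U ∧ d.1 ∈ S) ∨ (d.1 ∉ U ∧ d ∈ O)}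

/-- The edges above `m` are bioriented or unoriented according to `S`, those below `m` are as in
`O`, and `m` is unoriented. -/
def mix (O : G.Fourientation) (S : Set E(G)) (m : E(G)) : G.Fourientation :=
  {d | (m < d.1 ∧ d.1 ∈ S) ∨ (d.1 < m ∧ d ∈ O)}

/-- `S` arises from `O` by replacing the oriented edges one by one, beginning with the largest. -/
def IsReplacement (R : G.RefOrientation) (σu σb : E(G) → Bool) (O : G.Fourientation)
    (S : Set E(G)) : Prop :=
  ∀ m, m ∈ S ↔ m ∈ O.bioriented ∨
    (m ∈ O.oriented ∧ ((m, true) ∈ O ↔ R.KeepsPositive σu σb (mix O S m) m))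

lemma exists_set_of_recursion {ι : Type*} [LinearOrder ι] [Finite ι] (Φ : Set ι → ι → Prop)
    (hΦ : ∀ S T m, (∀ e, m < e → (e ∈ S ↔ e ∈ T)) → (Φ S m ↔ Φ T m)) :
    ∃ S : Set ι, ∀ m, m ∈ S ↔ Φ S m := by
  have wf : WellFounded fun a b : ι => b < a := wellFounded_gt
  -- Membership of `m` is computed with the set truncated to the elements above `m`; by `hΦ` this
  -- changes nothing.
  let F : ∀ m : ι, (∀ e, m < e → Prop) → Prop := fun m f => Φ {e | ∃ h : m < e, f e h} m
  refine ⟨{m | wf.fix F m}, fun m => ?_⟩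
  rw [Set.mem_ofPred_eq, wf.fix_eq]
  refine hΦ _ _ m fun e he => ?_
  simp [he]

lemma exists_isReplacement [Finite E(G)] (R : G.RefOrientation) (σu σb : E(G) → Bool)
    (O : G.Fourientation) : ∃ S, R.IsReplacement σu σb O S := by
  refine exists_set_of_recursion _ fun S T m h => ?_
  have : mix O S m = mix O T m := by
    ext d
    have := h d.1
    simp only [mix, Set.mem_ofPred_eq]
    tauto
  rw [this]

namespace IsReplacement

variable {O : G.Fourientation} {S : Set E(G)}

lemma notMem_of_unoriented (h : R.IsReplacement σu σb O S) {m : E(G)} (hm : m ∈ O.unoriented) :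
    m ∉ S := fun hS =>
  ((h m).1 hS).elim (fun hb => hm.1 hb.1) fun ho => ho.1.1 hm

lemma mem_of_bioriented (h : R.IsReplacement σu σb O S) {m : E(G)} (hm : m ∈ O.bioriented) :
    m ∈ S := (h m).2 (.inl hm)

lemma mem_iff_of_oriented (h : R.IsReplacement σu σb O S) {m : E(G)} (hm : m ∈ O.oriented) :
    m ∈ S ↔ ((m, true) ∈ O ↔ R.KeepsPositive σu σb (mix O S m) m) := by
  rw [h m, or_iff_right hm.2, and_iff_right hm]

lemma not_gains_of_mem (h : R.IsReplacement σu σb O S) {m : E(G)} {δ : Bool} (h1 : (m, δ) ∈ O)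
    (h2 : (m, !δ) ∉ O) (hS : m ∈ S) : ¬ R.Gains σu σb (mix O S m) m (!δ) := by
  rw [h.mem_iff_of_oriented (mem_oriented_iff.2 ⟨δ, h1, h2⟩)] at hS
  cases δ
  · have : (m, true) ∉ O := h2
    rw [KeepsPositive] at hS
    simp only [Bool.not_false]
    tauto
  · rcases hS.1 h1 with h | h
    · exact not_gains_not h
    · exact h.1

lemma not_gains_of_notMem (h : R.IsReplacement σu σb O S) {m : E(G)} {δ : Bool}
    (h1 : (m, δ) ∈ O) (h2 : (m, !δ) ∉ O) (hS : m ∉ S) : ¬ R.Gains σu σb (mix O S m) m δ := by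
  rw [h.mem_iff_of_oriented (mem_oriented_iff.2 ⟨δ, h1, h2⟩)] at hS
  cases δ
  · have h2' : (m, true) ∉ O := h2
    have : R.KeepsPositive σu σb (mix O S m) m := by
      by_contra hc
      exact hS (iff_of_false h2' hc)
    rcases this with h | h
    · exact not_gains_not h
    · exact h.1
  · rw [KeepsPositive] at hS
    tauto

lemma replaceOn_eq {U : Set E(G)} {m : E(G)} (hU : ∀ e, e ∈ U ↔ m < e) (d : G.Dart) :
    d ∈ replaceOn O S U ↔ d ∈ mix O S m ∨ (d.1 = m ∧ d ∈ O) := by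
  simp only [replaceOn, mix, Set.mem_ofPred_eq, hU, not_lt, le_iff_lt_or_eq]
  tauto

lemma replaceOn_insert_eq {U : Set E(G)} {m : E(G)} (hU : ∀ e, e ∈ U ↔ m < e) (d : G.Dart) :
    d ∈ replaceOn O S (insert m U) ↔ d ∈ mix O S m ∨ (d.1 = m ∧ m ∈ S) := by
  simp only [replaceOn, mix, Set.mem_ofPred_eq, Set.mem_insert_iff, hU, not_or, not_lt,
    le_iff_lt_or_eq]
  constructor
  · rintro (⟨h | h, h'⟩ | ⟨⟨h1, h2⟩, h3⟩)
    · exact .inr ⟨h, h ▸ h'⟩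
    · exact .inl (.inl ⟨h, h'⟩)
    · exact .inl (.inr ⟨h2.resolve_right h1, h3⟩)
  · rintro ((⟨h, h'⟩ | ⟨h, h'⟩) | ⟨h, h'⟩)
    · exact .inl ⟨.inr h, h'⟩
    · exact .inr ⟨⟨h.ne, .inl h⟩, h'⟩
    · exact .inl ⟨.inl h, h ▸ h'⟩

/-- A single step of the replacement. An oriented `m` is kept only if its opposite direction does
not gain, and dropped only if its own does not; in both cases the test of `e` is unaffected. -/
lemma returns_replaceOn_insert (h : R.IsReplacement σu σb O S) {U : Set E(G)} {m e : E(G)}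
    {k : Bool} (hU : ∀ e, e ∈ U ↔ m < e) (hem : e < m) (hk : Admissible k O e) :
    R.Returns σu σb k (replaceOn O S (insert m U)) e ↔
      R.Returns σu σb k (replaceOn O S U) e := by
  have hk' : Admissible k (mix O S m) e := by
    rwa [admissible_congr (O' := O)]
    intro δ
    simp [mix, hem, hem.not_gt]
  have e1 := replaceOn_eq (O := O) (S := S) hU
  have e2 := replaceOn_insert_eq (O := O) (S := S) hU
  by_cases hu : m ∈ O.unoriented
  · have hS := h.notMem_of_unoriented hu
    have : replaceOn O S (insert m U) = replaceOn O S U := by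
      ext ⟨f, ε⟩
      rw [e1, e2]
      have : ¬ (f = m ∧ (f, ε) ∈ O) := by
        rintro ⟨rfl, hf⟩
        cases ε
        exacts [hu.2 hf, hu.1 hf]
      tauto
    rw [this]
  by_cases hb : m ∈ O.bioriented
  · have hS := h.mem_of_bioriented hb
    have : replaceOn O S (insert m U) = replaceOn O S U := by
      ext ⟨f, ε⟩
      rw [e1, e2]
      have : f = m → (f, ε) ∈ O := by
        rintro rfl
        cases ε
        exacts [hb.2, hb.1]
      tauto
    rw [this]
  obtain ⟨δ, h1, h2⟩ := mem_oriented_iff.1 ⟨hu, hb⟩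
  rw [eq_insert_of_oriented h1 h2 e1]
  by_cases hS : m ∈ S
  · rw [eq_insert_insert_of_bioriented (M := replaceOn O S (insert m U)) (N := mix O S m) (m := m) δ
      (by simpa [hS] using e2)]
    exact returns_insert_insert_of_not_gains hem hk' (h.not_gains_of_mem h1 h2 hS)
  · have : replaceOn O S (insert m U) = mix O S m := by
      ext d
      simpa [hS] using e2 d
    rw [this]
    exact (returns_insert_of_not_gains hem hk' (h.not_gains_of_notMem h1 h2 hS)).symm

lemma returns_replaceOn (h : R.IsReplacement σu σb O S) {e : E(G)} {k : Bool}
    (hk : Admissible k O e) (U : Finset E(G)) (hU : IsUpperSet (U : Set E(G)))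
    (heU : ∀ u ∈ U, e < u) :
    R.Returns σu σb k (replaceOn O S U) e ↔ R.Returns σu σb k O e := by
  induction U using Finset.induction_on_min with
  | empty => simp [replaceOn]
  | insert m U hmin ih =>
    have hU' : ∀ f, f ∈ (U : Set E(G)) ↔ m < f := by
      refine fun f => ⟨hmin f, fun hf => ?_⟩
      have : f ∈ (↑(insert m U) : Set E(G)) := hU hf.le (by simp)
      simpa [hf.ne'] using this
    rw [Finset.coe_insert, h.returns_replaceOn_insert hU' (heU m (by simp)) hk]
    refine ih (fun a b hab ha => ?_) fun u hu => heU u (by simp [hu])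
    rw [hU'] at ha ⊢
    exact ha.trans_le hab

lemma returns_iff [Finite E(G)] (h : R.IsReplacement σu σb O S) {e : E(G)} {k : Bool}
    (hk : Admissible k O e) :
    R.Returns σu σb k O e ↔ R.Reach (window k (darts S) e) (R.tail e) (R.head e) := by
  have hfin : (Set.Ioi e).Finite := Set.toFinite _
  rw [← h.returns_replaceOn hk hfin.toFinset (by simpa using isUpperSet_Ioi e) (by simp), Returns,
    window_congr (O' := darts S), window_darts, reach_tail_head_iff]
  intro d hd
  simp [replaceOn, hd]

lemma window_mix (k : Bool) (m : E(G)) : window k (mix O S m) m = window k (darts S) m :=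
  window_congr fun d hd => by simp [mix, hd, hd.not_gt]

/-- A gain for `e < m` gives a path from the end of `m` through `e` to the start of `m`, and all of
it is available to the cut test of `m`. -/
lemma not_gains_of_not_reach {m : E(G)} {δ : Bool}
    (h : ¬ R.Reach (window true (darts S) m) (R.tail m) (R.head m)) :
    ¬ R.Gains σu σb (mix O S m) m δ := by
  rintro ⟨k, e, hem, -, -, h1, h2⟩
  have hsub : window k (mix O S m) e ⊆ window true (mix O S m) m := by
    rintro d (⟨hd, -⟩ | ⟨-, hd⟩)
    · rcases hd with hd | hd
      · exact .inl ⟨.inl hd, hd.1⟩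
      · exact .inr ⟨rfl, hd.1⟩
    · exact .inr ⟨rfl, hd.trans hem⟩
  have hmem : (e, testSign σu σb (mix O S m) e) ∈ window true (mix O S m) m := .inr ⟨rfl, hem⟩
  have key := (h2.mono hsub).trans ((reach_of_mem hmem).trans (h1.mono hsub))
  rw [window_mix, window_darts, reach_tail_head_iff] at key
  exact h key

/-- Larger edges of `S`, usable both ways, already join the ends of `m`, so a detour replaces `m`
and `e` returns without it. -/
lemma not_gains_of_reach {m : E(G)} {δ : Bool}
    (h : R.Reach (window false (darts S) m) (R.tail m) (R.head m)) :
    ¬ R.Gains σu σb (mix O S m) m δ := by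
  rintro ⟨k, e, hem, -, hr, h1, h2⟩
  have hsub : window false (mix O S m) m ⊆ window k (mix O S m) e := by
    rintro d (⟨hd, hlt⟩ | ⟨h, -⟩)
    · exact .inl ⟨hd, hem.trans hlt⟩
    · simp at h
  have key : R.Reach (window false (mix O S m) m) (R.source (m, δ)) (R.target (m, δ)) := by
    rw [window_mix, window_darts]
    exact reach_dart_of_reach δ h
  exact hr (h1.trans ((key.mono hsub).trans h2))

lemma keepsPositive_of_not_reach {m : E(G)}
    (h : ¬ R.Reach (window true (darts S) m) (R.tail m) (R.head m)) :
    R.KeepsPositive σu σb (mix O S m) m := by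
  refine .inr ⟨not_gains_of_not_reach h, fun hr => h ?_⟩
  rw [window_mix] at hr
  exact hr.mono (window_false_subset _ _ _)

lemma not_keepsPositive_of_reach {m : E(G)}
    (h : R.Reach (window false (darts S) m) (R.tail m) (R.head m)) :
    ¬ R.KeepsPositive σu σb (mix O S m) m := by
  rintro (hg | ⟨-, hr⟩)
  · exact not_gains_of_reach h hg
  · rw [window_mix] at hr
    exact hr h

/-- A fourientation is determined by its set of oriented edges and a replacement. -/
lemma eq_of_oriented_eq [Finite E(G)] {O' : G.Fourientation} (h : R.IsReplacement σu σb O S)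
    (h' : R.IsReplacement σu σb O' S) (ho : O.oriented = O'.oriented) : O = O' := by
  suffices ∀ (m : E(G)) (δ : Bool), (m, δ) ∈ O ↔ (m, δ) ∈ O' from Set.ext fun d => this d.1 d.2
  intro m
  -- Upward induction: once `O` and `O'` agree below `m`, they give the same `mix` at `m`, so
  -- membership of `m` in `S` reveals its direction.
  induction m using WellFoundedLT.induction with
  | ind m ih =>
    have hmix : mix O S m = mix O' S m := by
      ext d
      simp only [mix, Set.mem_ofPred_eq]
      exact or_congr_right (and_congr_right fun hd => ih d.1 hd d.2)
    by_cases hm : m ∈ O.oriented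
    · have hm' : m ∈ O'.oriented := ho ▸ hm
      have e1 := h.mem_iff_of_oriented hm
      have e2 := h'.mem_iff_of_oriented hm'
      rw [hmix] at e1
      have htrue : (m, true) ∈ O ↔ (m, true) ∈ O' := by tauto
      intro δ
      cases δ
      · obtain ⟨ε, a1, a2⟩ := mem_oriented_iff.1 hm
        obtain ⟨ε', b1, b2⟩ := mem_oriented_iff.1 hm'
        cases ε <;> cases ε' <;> simp_all
      · exact htrue
    · have hm' : m ∉ O'.oriented := ho ▸ hm
      have hb : m ∈ O.bioriented ↔ m ∈ O'.bioriented := by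
        have e1 := h m
        have e2 := h' m
        tauto
      simp only [Fourientation.oriented, Fourientation.unoriented, Fourientation.bioriented,
        Set.mem_ofPred_eq] at hm hm' hb
      intro δ
      cases δ <;> tauto

end IsReplacement

end RefOrientation
end Graph

/-! ### The main theorem. -/

theorem theorem2 {α β : Type*} (G : Graph α β) [Finite V(G)] [Finite E(G)]
    [LinearOrder E(G)] (R : G.RefOrientation) (σu σb : E(G) → Bool) :
    ∃ φ : G.Fourientation → G.SpanningSubgraph,
      -- `φ` is a `2^|E(G)|`-to-one surjection
      Function.Surjective φ ∧
      (∀ S : G.SpanningSubgraph, (φ ⁻¹' {S}).ncard = 2 ^ Nat.card E(G)) ∧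
      Function.Bijective
        (fun O : G.Fourientation =>
          ((φ O, O.oriented) : G.SpanningSubgraph × G.SpanningSubgraph)) ∧
      (∀ O : G.Fourientation, O.unoriented ∩ φ O = ∅ ∧ O.bioriented ⊆ φ O) ∧
      -- compatibility of `I(O) := Î(φ(O))` and `L(O) := L̂(φ(O))` with the direct definitions
      (∀ O : G.Fourientation,
        G.genCutActive (φ O) ∩ O.oriented = R.cutActiveOriented O ∧
        G.genCutActive (φ O) ∩ O.unoriented = R.cutActiveUnoriented σu O ∧
        G.genCycleActive (φ O) ∩ O.oriented = R.cycleActiveOriented O ∧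
        G.genCycleActive (φ O) ∩ O.bioriented = R.cycleActiveBioriented σb O) ∧
      -- compatibility of the signs
      (∀ O : G.Fourientation,
        G.genCutActive (φ O) ∩ O.positive ⊆ φ O ∧
        (G.genCutActive (φ O) ∩ O.negative) ∩ φ O = ∅ ∧
        G.genCycleActive (φ O) ∩ O.negative ⊆ φ O ∧
        (G.genCycleActive (φ O) ∩ O.positive) ∩ φ O = ∅) ∧
      (∀ O : G.Fourientation, O.oriented = ∅ →
        G.genCutActive (φ O) = G.genCutActive O.bioriented ∧
        G.genCycleActive (φ O) = G.genCycleActive O.bioriented) := by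
  open Graph Graph.RefOrientation in
  choose φ hφ using R.exists_isReplacement σu σb
  have hbij : Function.Bijective (fun O : G.Fourientation =>
      ((φ O, O.oriented) : G.SpanningSubgraph × G.SpanningSubgraph)) := by
    -- Injectivity suffices, since both sides have `2 ^ (2 * |E(G)|)` elements.
    refine (Nat.bijective_iff_injective_and_card _).2 ⟨fun O O' h => ?_, ?_⟩
    · obtain ⟨h1, h2⟩ := Prod.mk.inj h
      exact (hφ O).eq_of_oriented_eq (h1 ▸ hφ O') h2
    · have := Fintype.ofFinite E(G)
      simp only [Nat.card_eq_fintype_card, Fintype.card_set, Fintype.card_prod, Fintype.card_bool]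
      rw [← pow_add, mul_two]
  have hub : ∀ O : G.Fourientation, O.unoriented ∩ φ O = ∅ ∧ O.bioriented ⊆ φ O := fun O =>
    ⟨Set.eq_empty_of_forall_notMem fun _ he => (hφ O).notMem_of_unoriented he.1 he.2,
      fun _ he => (hφ O).mem_of_bioriented he⟩
  have hpos : ∀ {O : G.Fourientation} {e : E(G)}, e ∈ O.positive → e ∈ O.oriented :=
    fun h => ⟨fun hu => hu.1 h.1, fun hb => h.2 hb.2⟩
  have hneg : ∀ {O : G.Fourientation} {e : E(G)}, e ∈ O.negative → e ∈ O.oriented :=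
    fun h => ⟨fun hu => hu.2 h.2, fun hb => h.1 hb.1⟩
  refine ⟨φ, ?_, ?_, hbij, hub, fun O => ⟨?_, ?_, ?_, ?_⟩, fun O => ⟨?_, ?_, ?_, ?_⟩, ?_⟩
  · intro S
    obtain ⟨O, hO⟩ := hbij.2 (S, ∅)
    exact ⟨O, congrArg Prod.fst hO⟩
  · intro S
    -- By the bijection, a fibre of `φ` is parametrised by all possible sets of oriented edges.
    have himg : Fourientation.oriented '' (φ ⁻¹' {S}) = Set.univ := by
      refine Set.eq_univ_of_forall fun T => ?_
      obtain ⟨O, hO⟩ := hbij.2 (S, T)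
      exact ⟨O, congrArg Prod.fst hO, congrArg Prod.snd hO⟩
    have hinj : Set.InjOn Fourientation.oriented (φ ⁻¹' {S}) := fun O hO O' hO' h =>
      hbij.1 (Prod.ext ((show φ O = S from hO).trans (show φ O' = S from hO').symm) h)
    have := Fintype.ofFinite E(G)
    rw [← hinj.ncard_image, himg, Set.ncard_univ]
    simp
  · ext e
    rw [Set.mem_inter_iff, cutActiveOriented_iff (σu := σu) (σb := σb), and_comm,
      mem_genCutActive_iff (R := R)]
    refine and_congr_right fun he => ?_
    rw [(hφ O).returns_iff ⟨fun _ => he.2, fun _ => he.1⟩]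
  · ext e
    rw [Set.mem_inter_iff, cutActiveUnoriented_iff (σu := σu) (σb := σb), and_comm,
      mem_genCutActive_iff (R := R)]
    refine and_congr_right fun he => ?_
    rw [(hφ O).returns_iff ⟨fun _ hb => he.1 hb.1, fun h => by simp at h⟩]
  · ext e
    rw [Set.mem_inter_iff, cycleActiveOriented_iff (σu := σu) (σb := σb), and_comm,
      mem_genCycleActive_iff (R := R)]
    refine and_congr_right fun he => ?_
    rw [(hφ O).returns_iff ⟨fun _ => he.2, fun _ => he.1⟩]
  · ext e
    rw [Set.mem_inter_iff, cycleActiveBioriented_iff (σu := σu) (σb := σb), and_comm,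
      mem_genCycleActive_iff (R := R)]
    refine and_congr_right fun he => ?_
    rw [(hφ O).returns_iff ⟨fun h => by simp at h, fun _ hu => hu.1 he.1⟩]
  · rintro e ⟨he, hp⟩
    rw [mem_genCutActive_iff (R := R)] at he
    rw [(hφ O).mem_iff_of_oriented (hpos hp)]
    exact iff_of_true hp.1 (IsReplacement.keepsPositive_of_not_reach he)
  · refine Set.eq_empty_of_forall_notMem ?_
    rintro e ⟨⟨he, hn⟩, hS⟩
    rw [mem_genCutActive_iff (R := R)] at he
    rw [(hφ O).mem_iff_of_oriented (hneg hn)] at hS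
    exact hn.1 (hS.2 (IsReplacement.keepsPositive_of_not_reach he))
  · rintro e ⟨he, hn⟩
    rw [mem_genCycleActive_iff (R := R)] at he
    rw [(hφ O).mem_iff_of_oriented (hneg hn)]
    exact iff_of_false hn.1 (IsReplacement.not_keepsPositive_of_reach he)
  · refine Set.eq_empty_of_forall_notMem ?_
    rintro e ⟨⟨he, hp⟩, hS⟩
    rw [mem_genCycleActive_iff (R := R)] at he
    rw [(hφ O).mem_iff_of_oriented (hpos hp)] at hS
    exact IsReplacement.not_keepsPositive_of_reach he (hS.1 hp.1)
  · intro O hO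
    have : φ O = O.bioriented := by
      refine Set.Subset.antisymm (fun e he => ?_) (hub O).2
      refine ((hφ O e).1 he).resolve_right fun h => ?_
      rw [hO] at h
      exact h.1
    rw [this]
    exact ⟨rfl, rfl⟩
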